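/- For a finite Coxeter group $W$ with set of simple reflections $S$ and length function $\ell_S$, let $\operatorname{des}(w)=|\{s\in S : \ell_S(ws)<\ell_S(w)\}|$ and $t(w)=\operatorname{des}(w)+\operatorname{des}(w^{-1})$ for $w\in W$, and let $T_W$ be the random variable $t(w)$, where $w$ is chosen uniformly at random from $W$. Theorem. Irreducible Coxeter groups of type $A_n$, $B_n$ or $D_n$ are finite, and the fourth centred moment of $T_W$ for such $W$ is of order $n^2$. That is, there are constants $c,C>0$ such that for every irreducible Coxeter group $W$ of type $A_n$ ($n\ge 1$), $B_n$ ($n\ge 1$, where $B_1=A_1$) or $D_n$ ($n\ge 3$, where $D_3=A_3$), $$c\,n^2\;\le\;\mathbb{E}\bigl((T_W-\mathbb{E}(T_W))^4\bigr)\;\le\;C\,n^2 .$$ -/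

import Mathlib

open MeasureTheory ProbabilityTheory

/-- The Coxeter matrix of type `D_n` (for `n ≥ 3`): the nodes `0, 1, …, n - 2` form a path and the
last node `n - 1` is joined to `n - 3` only; joined nodes have label `3`.
(Mathlib's `CoxeterMatrix.D n` in addition joins the nodes `n - 2` and `n - 1`, so that its diagram
contains a triangle and is not the diagram of type `D_n`.) -/
def typeDMatrix (n : ℕ) : CoxeterMatrix (Fin n) where
  M := Matrix.of fun i j : Fin n ↦
    if i = j then 1
    else if ((i : ℕ) + 1 = j ∧ (j : ℕ) + 1 < n) ∨ ((j : ℕ) + 1 = i ∧ (i : ℕ) + 1 < n) ∨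
        ((i : ℕ) + 2 = j ∧ (j : ℕ) + 1 = n) ∨ ((j : ℕ) + 2 = i ∧ (i : ℕ) + 1 = n) then 3
    else 2
  isSymm := by
    ext i j
    simp only [Matrix.transpose_apply, Matrix.of_apply]
    split_ifs <;> first | rfl | (exfalso; grind)
  diagonal := by simp
  off_diagonal := by
    intro i j h
    simp only [Matrix.of_apply, if_neg h]
    split_ifs <;> decide

/-- `M` is, up to relabelling the simple reflections, the Coxeter matrix `M'`. -/
def CoxeterMatrix.IsOfType {ι κ : Type*} (M : CoxeterMatrix ι) (M' : CoxeterMatrix κ) : Prop :=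
  ∃ e : ι ≃ κ, M.reindex e = M'

/-- `M` is the Coxeter matrix of an irreducible Coxeter group of type `A_n`, `B_n` or `D_n`.
The bounds on `n` are exactly those for which the diagram is non-empty and connected
(`B_1 = A_1` and `D_3 = A_3` are included). -/
def CoxeterMatrix.IsIrreducibleABD {ι : Type*} (M : CoxeterMatrix ι) (n : ℕ) : Prop :=
  (1 ≤ n ∧ M.IsOfType (CoxeterMatrix.A n)) ∨
  (1 ≤ n ∧ M.IsOfType (CoxeterMatrix.B n)) ∨
  (3 ≤ n ∧ M.IsOfType (typeDMatrix n))

namespace CoxeterSystem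

variable {ι W : Type*} [Group W] {M : CoxeterMatrix ι}

/-- The number of descents of `w`: the number of simple reflections `s` with `ℓ(ws) < ℓ(w)`. -/
noncomputable def des (cs : CoxeterSystem M W) (w : W) : ℕ :=
  {i : ι | cs.IsRightDescent w i}.ncard

/-- The statistic `t(w) = des(w) + des(w⁻¹)`. -/
noncomputable def tStat (cs : CoxeterSystem M W) (w : W) : ℕ :=
  cs.des w + cs.des w⁻¹

/-- The fourth centred moment `𝔼((T_W - 𝔼(T_W))^4)`, where `T_W` is the value of `tStat` at
an element of `W` chosen uniformly at random (all subsets of `W` being measurable). -/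
noncomputable def fourthCentredMomentT (cs : CoxeterSystem M W) : ℝ :=
  letI : MeasurableSpace W := ⊤
  centralMoment (fun w : W ↦ (cs.tStat w : ℝ)) 4 (uniformOn (Set.univ : Set W))

end CoxeterSystem

/-! Write X(w) for des(w) minus its mean, a sum over the nodes i of X_i = ±1/2. Then T_W minus its
mean is X(w) + X(w⁻¹). Upper bound: right multiplication by s_i negates X_i and fixes X_j whenever i
and j are non-adjacent, so X_i is orthogonal to every function invariant under w ↦ w s_i. Up to a
bounded local part A, X is such a function (`exists_local_decomposition`). Replacing X³ by X³ - (X -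
A)³ in E(X_i X³) and summing over i gives E(X²) = O(n), then E(X⁴) = O(n²). Lower bound: by
Cauchy–Schwarz it suffices that the variance of T_W is at least linear in n. X(w) and X(w⁻¹) are
non-negatively correlated, and E(X_i X_j) is bounded below by counting shortest and longest elements
in dihedral cosets (`le_sum_centredDescent_mul`). Summed over the diagram, these bounds give at
least n/24. Both halves need to know how multiplication by a generator affects descents; this comes
from the parity cocycle `inversionParity`. Finiteness comes from a double coset decomposition for
groups with relations of type B, into which all three types embed. -/

theorem Function.End.mul_apply' {α : Type*} (f g : Function.End α) (x : α) :
    (f * g) x = f (g x) := rfl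

theorem Function.End.one_apply' {α : Type*} (x : α) : (1 : Function.End α) x = x := rfl

/-! ### Inversion parity and descents -/

namespace CoxeterSystem

variable {ι W : Type*} [Group W] {M : CoxeterMatrix ι} (cs : CoxeterSystem M W)

open Classical in
/-- The action of the `i`-th generator on pairs of a group element and a sign, conjugating the
element and flipping the sign exactly at the simple reflection. -/
noncomputable def signedConj (i : ι) : Function.End (W × ZMod 2) := fun p ↦
  (cs.simple i * p.1 * cs.simple i, p.2 + if p.1 = cs.simple i then 1 else 0)

theorem simple_mul_pow_mul_simple (i j : ι) (k : ℕ) :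
    cs.simple j * (cs.simple i * cs.simple j) ^ k =
      ((cs.simple i * cs.simple j) ^ k)⁻¹ * cs.simple j := by
  have h : SemiconjBy (cs.simple j) (cs.simple i * cs.simple j)
      (cs.simple i * cs.simple j)⁻¹ := by
    simp [SemiconjBy, mul_assoc]
  simpa only [inv_pow] using (h.pow_right k).eq

-- The letters of (s_i s_j)^k flip the sign at the reflections c^(-r) s_j with c = s_i s_j and r <
-- 2k; each further factor c contributes r = 2k (from s_j) and r = 2k + 1 (from s_i).
open Classical in
theorem signedConj_mul_pow (i j : ι) (k : ℕ) (p : W × ZMod 2) :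
    ((cs.signedConj i * cs.signedConj j) ^ k) p =
      ((cs.simple i * cs.simple j) ^ k * p.1 * ((cs.simple i * cs.simple j) ^ k)⁻¹,
        p.2 + ∑ r ∈ Finset.range (2 * k),
          if p.1 = ((cs.simple i * cs.simple j) ^ r)⁻¹ * cs.simple j then 1 else 0) := by
  induction k with
  | zero => simp [Function.End.one_apply']
  | succ k ih =>
    obtain ⟨t, ε⟩ := p
    have hc := cs.simple_mul_pow_mul_simple i j k
    set c := cs.simple i * cs.simple j with hcdef
    have hji : cs.simple j * cs.simple i = c⁻¹ := by simp [hcdef]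
    have h1 : c ^ k * t * (c ^ k)⁻¹ = cs.simple j ↔ t = (c ^ (2 * k))⁻¹ * cs.simple j := by
      rw [mul_inv_eq_iff_eq_mul, hc, ← eq_inv_mul_iff_mul_eq, ← mul_assoc, two_mul, pow_add,
        mul_inv_rev]
    have h2 : cs.simple j * (c ^ k * t * (c ^ k)⁻¹) * cs.simple j = cs.simple i ↔
        t = (c ^ (2 * k + 1))⁻¹ * cs.simple j := by
      have e : cs.simple j * (c ^ k * t * (c ^ k)⁻¹) * cs.simple j = cs.simple i ↔
          c ^ k * t * (c ^ k)⁻¹ = c⁻¹ * cs.simple j := by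
        rw [← hji]
        constructor
        · intro h
          rw [← h]
          simp [mul_assoc]
        · intro h
          rw [h]
          simp [mul_assoc]
      rw [e, mul_inv_eq_iff_eq_mul, mul_assoc, hc, ← eq_inv_mul_iff_mul_eq]
      have : (c ^ (2 * k + 1))⁻¹ = (c ^ k)⁻¹ * (c⁻¹ * (c ^ k)⁻¹) := by group
      rw [this]
      simp only [mul_assoc]
    rw [pow_succ', Function.End.mul_apply', ih, Function.End.mul_apply']
    simp only [signedConj, h1, h2, Prod.mk.injEq]
    constructor
    · rw [pow_succ' c k, mul_inv_rev, ← hji, hcdef]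
      simp only [mul_assoc, hji]
    · rw [show 2 * (k + 1) = 2 * k + 1 + 1 by ring, Finset.sum_range_succ, Finset.sum_range_succ]
      ring

/-- For k = m the 2m reflections repeat with period m because c^m = 1, so the flips cancel in pairs
modulo 2. -/
theorem isLiftable_signedConj : M.IsLiftable cs.signedConj := by
  classical
  intro i j
  funext p
  have hc := cs.simple_mul_simple_pow i j
  rw [signedConj_mul_pow, hc, two_mul, Finset.sum_range_add]
  simp only [pow_add, hc, one_mul, CharTwo.add_self_eq_zero]
  simp [Function.End.one_apply']

/-- The action of `W` on `W × ZMod 2` extending `signedConj`. -/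
noncomputable def signedConjHom : W →* Function.End (W × ZMod 2) :=
  cs.lift ⟨cs.signedConj, cs.isLiftable_signedConj⟩

theorem signedConjHom_simple (i : ι) : cs.signedConjHom (cs.simple i) = cs.signedConj i :=
  cs.lift_apply_simple _ i

/-- The parity of the number of occurrences of `t` in the right inversion sequence of a word
for `w`. -/
noncomputable def inversionParity (w t : W) : ZMod 2 := (cs.signedConjHom w (t, 0)).2

theorem signedConjHom_apply (w t : W) (ε : ZMod 2) :
    cs.signedConjHom w (t, ε) = (w * t * w⁻¹, ε + cs.inversionParity w t) := by
  induction w using cs.simple_induction_left generalizing ε with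
  | one => simp [inversionParity, Function.End.one_apply']
  | mul_simple_left w i ih =>
    have key : ∀ ε, cs.signedConjHom (cs.simple i * w) (t, ε) =
        cs.signedConj i (w * t * w⁻¹, ε + cs.inversionParity w t) := by
      intro ε
      rw [map_mul, Function.End.mul_apply', ih, signedConjHom_simple]
    rw [inversionParity, key, key]
    simp [signedConj, mul_assoc, add_assoc]

theorem inversionParity_mul (u w t : W) :
    cs.inversionParity (u * w) t =
      cs.inversionParity w t + cs.inversionParity u (w * t * w⁻¹) := by
  rw [inversionParity, map_mul, Function.End.mul_apply', signedConjHom_apply,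
    signedConjHom_apply, zero_add]

open Classical in
theorem inversionParity_simple (i : ι) (t : W) :
    cs.inversionParity (cs.simple i) t = if t = cs.simple i then 1 else 0 := by
  simp [inversionParity, signedConjHom_simple, signedConj]

theorem exists_eq_simple_mul_of_ne_one {w : W} (hw : w ≠ 1) :
    ∃ i v, w = cs.simple i * v ∧ cs.length w = cs.length v + 1 := by
  obtain ⟨ω, hω, rfl⟩ := cs.exists_isReduced w
  cases ω with
  | nil => simp at hw
  | cons i ω =>
    refine ⟨i, cs.wordProd ω, cs.wordProd_cons i ω, ?_⟩
    have h1 : cs.length (cs.wordProd (i :: ω)) = ω.length + 1 := hω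
    have h2 : cs.length (cs.wordProd ω) = ω.length := (by simpa using hω.drop 1 : cs.IsReduced ω)
    omega

/-- The exchange property. With w = s_i v reduced, odd parity comes either from v, where induction
applies, or from v t v⁻¹ = s_i, where w t = v. -/
theorem length_mul_lt_of_inversionParity_ne_zero {t : W} (ht : t * t = 1) (w : W)
    (h : cs.inversionParity w t ≠ 0) : cs.length (w * t) < cs.length w := by
  classical
  induction hn : cs.length w generalizing w with
  | zero =>
    rw [cs.length_eq_zero_iff] at hn
    subst hn
    simp [inversionParity, Function.End.one_apply'] at h
  | succ n ih =>
    have hw : w ≠ 1 := by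
      rintro rfl
      simp at hn
    obtain ⟨i, v, rfl, hl⟩ := cs.exists_eq_simple_mul_of_ne_one hw
    rw [inversionParity_mul, inversionParity_simple] at h
    by_cases hv : cs.inversionParity v t = 0
    · have e : v * t * v⁻¹ = cs.simple i := by
        by_contra hne
        simp [hv, hne] at h
      have e' : cs.simple i * v * t = v := by
        rw [← e, inv_mul_cancel_right, mul_assoc, ht, mul_one]
      rw [e']
      omega
    · have := ih v hv (by omega)
      have h3 := cs.length_mul_le (cs.simple i) (v * t)
      rw [cs.length_simple, ← mul_assoc] at h3
      omega

/-- If the parity vanished at a descent, it would be odd for w s_i, and then w = (w s_i) s_i would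
be shorter than w s_i. -/
theorem isRightDescent_iff_inversionParity (w : W) (i : ι) :
    cs.IsRightDescent w i ↔ cs.inversionParity w (cs.simple i) ≠ 0 := by
  constructor
  · intro h h0
    have h1 : cs.inversionParity (w * cs.simple i) (cs.simple i) ≠ 0 := by
      rw [inversionParity_mul, inversionParity_simple]
      simp [h0]
    have := cs.length_mul_lt_of_inversionParity_ne_zero (by simp) _ h1
    rw [simple_mul_simple_cancel_right] at this
    exact lt_asymm h this
  · exact cs.length_mul_lt_of_inversionParity_ne_zero (by simp) w

theorem isRightDescent_mul_simple_iff_of_commute {i j : ι} (hne : cs.simple i ≠ cs.simple j)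
    (hc : Commute (cs.simple i) (cs.simple j)) (w : W) :
    cs.IsRightDescent (w * cs.simple i) j ↔ cs.IsRightDescent w j := by
  rw [isRightDescent_iff_inversionParity, isRightDescent_iff_inversionParity,
    inversionParity_mul, inversionParity_simple, if_neg hne.symm, hc.eq, mul_inv_cancel_right,
    zero_add]

theorem isRightDescent_simple_mul_iff {i j : ι} {w : W}
    (hne : cs.simple j * w ≠ w * cs.simple i) :
    cs.IsRightDescent (cs.simple j * w) i ↔ cs.IsRightDescent w i := by
  rw [isRightDescent_iff_inversionParity, isRightDescent_iff_inversionParity,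
    inversionParity_mul, inversionParity_simple, if_neg, add_zero]
  intro h
  rw [mul_inv_eq_iff_eq_mul] at h
  exact hne h.symm

theorem isRightDescent_mul_simple_self_iff (w : W) (i : ι) :
    cs.IsRightDescent (w * cs.simple i) i ↔ ¬ cs.IsRightDescent w i := by
  have := cs.length_mul_simple w i
  simp only [IsRightDescent, simple_mul_simple_cancel_right]
  omega

/-! ### Distinct nodes give distinct simple reflections -/

/-- The action of the `i`-th generator on `ZMod 2`-labellings of the diagram, adding the label
of `i` to the labels of its neighbours along edges of weight `3`. -/
def toggle (M : CoxeterMatrix ι) (i : ι) : Function.End (ι → ZMod 2) := fun v k ↦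
  v k + (if M i k = 3 then 1 else 0) * v i

/-- Only the labels at i, j and k matter, so each relation is a finite check. Edges of weight 4 may
be ignored: the toggles then commute. -/
theorem isLiftable_toggle (hM : ∀ i j, M i j ∈ ({1, 2, 3, 4} : Set ℕ)) :
    M.IsLiftable (toggle M) := by
  intro i j
  have hs : M j i = M i j := M.symmetric j i
  have h4 := hM i j
  simp only [Set.mem_insert_iff, Set.mem_singleton_iff] at h4
  funext v k
  have hpow : ∀ m, ((toggle M i * toggle M j) ^ (m + 1)) v =
      toggle M i (toggle M j (((toggle M i * toggle M j) ^ m) v)) := by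
    intro m
    rw [pow_succ']
    rfl
  have hij : M i j = 1 → i = j := by
    intro h
    by_contra hne
    exact M.off_diagonal i j hne h
  rcases h4 with h | h | h | h
  · obtain rfl := hij h
    simp only [h, hpow, pow_zero, Function.End.one_apply', toggle]
    generalize (if M i k = 3 then (1 : ZMod 2) else 0) = a
    generalize v k = x
    generalize v i = y
    revert x y a
    decide
  all_goals
    simp only [h, hs, hpow, pow_zero, Function.End.one_apply', toggle, M.diagonal]
    generalize (if M i k = 3 then (1 : ZMod 2) else 0) = a
    generalize (if M j k = 3 then (1 : ZMod 2) else 0) = b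
    generalize v k = x
    generalize v i = y
    generalize v j = z
    revert x y z a b
    decide

/-- If i has an edge of weight 3, its toggle differs from that of j on the indicator of i. Otherwise
every relation involving i is even in s_i, and the character to `ZMod 2` that is non-trivial only on
s_i separates them. -/
theorem simple_injective (hM : ∀ i j, M i j ∈ ({1, 2, 3, 4} : Set ℕ)) :
    Function.Injective cs.simple := by
  classical
  intro i j hij
  by_contra hne
  by_cases hk : ∃ k, M i k = 3
  · obtain ⟨k, hk⟩ := hk
    have h : toggle M i = toggle M j := by
      rw [← cs.lift_apply_simple (isLiftable_toggle hM) i, hij, cs.lift_apply_simple]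
    have h' := congrFun (congrFun h (Pi.single i 1)) k
    simp [toggle, hk, Ne.symm hne] at h'
  · push Not at hk
    have hlift : M.IsLiftable fun k ↦ Multiplicative.ofAdd (if k = i then (1 : ZMod 2) else 0) := by
      intro a b
      have h4 := hM a b
      simp only [Set.mem_insert_iff, Set.mem_singleton_iff] at h4
      have h1 : M a b = 1 → a = b := by
        intro h
        by_contra hne
        exact M.off_diagonal a b hne h
      have h3 : M a b = 3 → a ≠ i ∧ b ≠ i := by
        refine fun h ↦ ⟨?_, ?_⟩
        · rintro rfl
          exact hk _ h
        · rintro rfl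
          exact hk a (M.symmetric a b ▸ h)
      rcases h4 with h | h | h | h
      · obtain rfl := h1 h
        simp only [h, ← ofAdd_add, pow_one, CharTwo.add_self_eq_zero, ofAdd_zero]
      · simp only [h, ← ofAdd_add, ← ofAdd_nsmul, CharTwo.two_nsmul, ofAdd_zero]
      · simp [(h3 h).1, (h3 h).2]
      · rw [h, ← ofAdd_add, ← ofAdd_nsmul, show 4 = 2 * 2 by rfl, mul_nsmul, CharTwo.two_nsmul,
          ofAdd_zero]
    have h := cs.lift_apply_simple hlift i
    rw [hij, cs.lift_apply_simple hlift j] at h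
    simp only [Ne.symm hne, if_false, if_true] at h
    exact absurd (Multiplicative.ofAdd.injective h) (by decide)

end CoxeterSystem

/-! ### Finiteness from the relations of type B -/

/-- The relations of type `B` for the first `N` terms of a sequence of group elements. The zeroth
element is allowed to be trivial, so that the remaining ones then satisfy the relations of
type `A`. -/
structure SatisfiesTypeBRelations {G : Type*} [Group G] (s : ℕ → G) (N : ℕ) : Prop where
  mul_self : ∀ i < N, s i * s i = 1
  commute_conj : 1 < N → Commute (s 1 * s 0 * s 1) (s 0)
  braid : ∀ i, 1 ≤ i → i + 1 < N → s i * s (i + 1) * s i = s (i + 1) * s i * s (i + 1)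
  commute : ∀ i j, i + 1 < j → j < N → Commute (s i) (s j)

/-- The iterated conjugate of `s 0`; in the hyperoctahedral group, the sign change of the
coordinate `n`. -/
def signChange {G : Type*} [Group G] (s : ℕ → G) : ℕ → G
  | 0 => s 0
  | n + 1 => s (n + 1) * signChange s n * s (n + 1)

namespace SatisfiesTypeBRelations

variable {G : Type*} [Group G] {s : ℕ → G} {N : ℕ} (h : SatisfiesTypeBRelations s N)
include h

theorem commute_signChange_of_lt {n j : ℕ} (hnj : n + 1 < j) (hj : j < N) :
    Commute (signChange s n) (s j) := by
  induction n with
  | zero => exact h.commute 0 j hnj hj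
  | succ n ih =>
    have h1 := h.commute (n + 1) j hnj hj
    exact (h1.mul_left (ih (by omega))).mul_left h1

theorem commute_signChange {n i : ℕ} (hi : i < n) (hn : n < N) :
    Commute (signChange s n) (s i) := by
  induction n with
  | zero => omega
  | succ n ih =>
    rcases Nat.lt_succ_iff_lt_or_eq.mp hi with hlt | rfl
    · have h1 := (h.commute i (n + 1) (by omega) hn).symm
      exact (h1.mul_left (ih hlt (by omega))).mul_left h1
    · cases i with
      | zero => exact h.commute_conj hn
      | succ m =>
        have hb := h.braid (m + 1) (by omega) hn
        have hc := (h.commute_signChange_of_lt (n := m) (j := m + 1 + 1) (by omega) hn).eq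
        simp only [signChange]
        generalize signChange s m = r at *
        generalize s (m + 1 + 1) = b at *
        generalize s (m + 1) = a at *
        change b * (a * r * a) * b * a = a * (b * (a * r * a) * b)
        calc b * (a * r * a) * b * a = b * a * r * (a * b * a) := by group
          _ = b * a * (r * b) * a * b := by rw [hb]; group
          _ = (b * a * b) * r * a * b := by rw [hc]; group
          _ = _ := by rw [← hb]; group

/-- With H_n generated by s_0, …, s_(n-1) and r_n the sign change, H_(n+1) = H_n ∪ H_n s_n H_n ∪ H_n
r_n, since the right side is stable under right multiplication by generators. The middle piece is
omitted for n = 0, where s_0 = r_0; this keeps the braid relation available whenever that piece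
occurs. -/
theorem mem_closure_succ {n : ℕ} (hn : n < N) {x : G}
    (hx : x ∈ Subgroup.closure (s '' Set.Iio (n + 1))) :
    x ∈ Subgroup.closure (s '' Set.Iio n) ∨
      (1 ≤ n ∧ ∃ a ∈ Subgroup.closure (s '' Set.Iio n), ∃ b ∈ Subgroup.closure (s '' Set.Iio n),
        x = a * s n * b) ∨
      ∃ a ∈ Subgroup.closure (s '' Set.Iio n), x = a * signChange s n := by
  induction n generalizing x with
  | zero =>
    have hmul : ∀ y, (y = 1 ∨ y = s 0) → (y * s 0 = 1 ∨ y * s 0 = s 0) := by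
      rintro y (rfl | rfl)
      · simp
      · exact Or.inl (h.mul_self 0 hn)
    have hinv : (s 0)⁻¹ = s 0 := inv_eq_of_mul_eq_one_right (h.mul_self 0 hn)
    have : x = 1 ∨ x = s 0 := by
      induction hx using Subgroup.closure_induction_right with
      | one => simp
      | mul_right y _ g hg ih =>
        obtain ⟨i, hi, rfl⟩ := hg
        obtain rfl : i = 0 := by simpa using hi
        exact hmul _ ih
      | mul_inv_cancel y _ g hg ih =>
        obtain ⟨i, hi, rfl⟩ := hg
        obtain rfl : i = 0 := by simpa using hi
        rw [hinv]
        exact hmul _ ih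
    rcases this with rfl | rfl
    · exact Or.inl (one_mem _)
    · exact Or.inr (Or.inr ⟨1, one_mem _, by simp [signChange]⟩)
  | succ n ih =>
    have hmono : Subgroup.closure (s '' Set.Iio n) ≤ Subgroup.closure (s '' Set.Iio (n + 1)) :=
      Subgroup.closure_mono (Set.image_mono (Set.Iio_subset_Iio (by omega)))
    have hsmem : s n ∈ Subgroup.closure (s '' Set.Iio (n + 1)) :=
      Subgroup.subset_closure ⟨n, by simp, rfl⟩
    have hrmem : signChange s n ∈ Subgroup.closure (s '' Set.Iio (n + 1)) := by
      clear ih hn hmono hsmem hx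
      induction n with
      | zero => exact Subgroup.subset_closure ⟨0, by simp, rfl⟩
      | succ n ih =>
        have hs : s (n + 1) ∈ Subgroup.closure (s '' Set.Iio (n + 1 + 1)) :=
          Subgroup.subset_closure ⟨n + 1, by simp, rfl⟩
        exact mul_mem (mul_mem hs (Subgroup.closure_mono
          (Set.image_mono (Set.Iio_subset_Iio (by omega))) ih)) hs
    have hcomm : ∀ g ∈ Subgroup.closure (s '' Set.Iio n), Commute g (s (n + 1)) := by
      intro g hg
      induction hg using Subgroup.closure_induction with
      | mem g hg =>
        obtain ⟨i, hi, rfl⟩ := hg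
        exact h.commute i (n + 1) (by simpa using hi) hn
      | one => exact Commute.one_left _
      | mul _ _ _ _ h1 h2 => exact h1.mul_left h2
      | inv _ _ h1 => exact h1.inv_left
    have hss : s (n + 1) * s (n + 1) = 1 := h.mul_self _ hn
    have hmul : ∀ y, (y ∈ Subgroup.closure (s '' Set.Iio (n + 1)) ∨
        (∃ a ∈ Subgroup.closure (s '' Set.Iio (n + 1)),
          ∃ b ∈ Subgroup.closure (s '' Set.Iio (n + 1)), y = a * s (n + 1) * b) ∨
        ∃ a ∈ Subgroup.closure (s '' Set.Iio (n + 1)), y = a * signChange s (n + 1)) →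
        ∀ i < n + 2, (y * s i ∈ Subgroup.closure (s '' Set.Iio (n + 1)) ∨
        (∃ a ∈ Subgroup.closure (s '' Set.Iio (n + 1)),
          ∃ b ∈ Subgroup.closure (s '' Set.Iio (n + 1)), y * s i = a * s (n + 1) * b) ∨
        ∃ a ∈ Subgroup.closure (s '' Set.Iio (n + 1)), y * s i = a * signChange s (n + 1)) := by
      intro y hy i hi
      rcases Nat.lt_succ_iff_lt_or_eq.mp hi with hlt | rfl
      · have hmem : s i ∈ Subgroup.closure (s '' Set.Iio (n + 1)) :=
          Subgroup.subset_closure ⟨i, hlt, rfl⟩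
        rcases hy with hy | ⟨a, ha, b, hb, rfl⟩ | ⟨a, ha, rfl⟩
        · exact Or.inl (mul_mem hy hmem)
        · exact Or.inr (Or.inl ⟨a, ha, b * s i, mul_mem hb hmem, by group⟩)
        · refine Or.inr (Or.inr ⟨a * s i, mul_mem ha hmem, ?_⟩)
          rw [mul_assoc, (h.commute_signChange hlt hn).eq, mul_assoc]
      · rcases hy with hy | ⟨a, ha, b, hb, rfl⟩ | ⟨a, ha, rfl⟩
        · exact Or.inr (Or.inl ⟨y, hy, 1, one_mem _, by group⟩)
        -- The essential product is s_(n+1) b s_(n+1). Decompose b one level down: its H_n factors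
        -- commute with s_(n+1), and what remains is cancellation, a braid move, or the definition
        -- of r_(n+1).
        · rcases ih (by omega) hb with hb | ⟨hn1, p, hp, q, hq, rfl⟩ | ⟨p, hp, rfl⟩
          · refine Or.inl ?_
            rw [mul_assoc a, ← (hcomm b hb).eq, mul_assoc a, mul_assoc b, hss, mul_one]
            exact mul_mem ha (hmono hb)
          · refine Or.inr (Or.inl ⟨a * p * s n, mul_mem (mul_mem ha (hmono hp)) hsmem, s n * q,
              mul_mem hsmem (hmono hq), ?_⟩)
            calc a * s (n + 1) * (p * s n * q) * s (n + 1)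
                = a * (s (n + 1) * p) * s n * (q * s (n + 1)) := by group
              _ = a * p * (s (n + 1) * s n * s (n + 1)) * q := by
                rw [← (hcomm p hp).eq, (hcomm q hq).eq]; group
              _ = _ := by rw [← h.braid n hn1 hn]; group
          · refine Or.inr (Or.inr ⟨a * p, mul_mem ha (hmono hp), ?_⟩)
            calc a * s (n + 1) * (p * signChange s n) * s (n + 1)
                = a * (s (n + 1) * p) * signChange s n * s (n + 1) := by group
              _ = a * p * (s (n + 1) * signChange s n * s (n + 1)) := by
                rw [← (hcomm p hp).eq]; group
        · refine Or.inr (Or.inl ⟨a, ha, signChange s n, hrmem, ?_⟩)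
          rw [signChange, mul_assoc a, mul_assoc _ _ (s (n + 1)), hss, mul_one, mul_assoc]
    suffices hsuff : x ∈ Subgroup.closure (s '' Set.Iio (n + 1)) ∨
        (∃ a ∈ Subgroup.closure (s '' Set.Iio (n + 1)),
          ∃ b ∈ Subgroup.closure (s '' Set.Iio (n + 1)), x = a * s (n + 1) * b) ∨
        ∃ a ∈ Subgroup.closure (s '' Set.Iio (n + 1)), x = a * signChange s (n + 1) from
      hsuff.imp_right (Or.imp_left fun hx ↦ ⟨by omega, hx⟩)
    induction hx using Subgroup.closure_induction_right with
    | one => exact Or.inl (one_mem _)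
    | mul_right y _ g hg ih =>
      obtain ⟨i, hi, rfl⟩ := hg
      exact hmul _ ih i hi
    | mul_inv_cancel y _ g hg ih =>
      obtain ⟨i, hi, rfl⟩ := hg
      rw [inv_eq_of_mul_eq_one_right (h.mul_self i (lt_of_lt_of_le hi (by omega)))]
      exact hmul _ ih i hi

theorem finite_closure {n : ℕ} (hn : n ≤ N) :
    (Subgroup.closure (s '' Set.Iio n) : Set G).Finite := by
  induction n with
  | zero => simp
  | succ n ih =>
    have hf := ih (by omega)
    refine ((hf.union (Set.Finite.image2 (fun a b ↦ a * s n * b) hf hf)).union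
      (hf.image fun a ↦ a * signChange s n)).subset ?_
    intro x hx
    rcases h.mem_closure_succ (by omega) hx with hx | ⟨-, a, ha, b, hb, rfl⟩ | ⟨a, ha, rfl⟩
    · exact Or.inl (Or.inl hx)
    · exact Or.inl (Or.inr ⟨a, ha, b, hb, rfl⟩)
    · exact Or.inr ⟨a, ha, rfl⟩

end SatisfiesTypeBRelations

/-! ### Finiteness in types A, B and D -/

namespace CoxeterSystem

variable {ι W : Type*} [Group W] {M : CoxeterMatrix ι} (cs : CoxeterSystem M W)

theorem commute_simple {i j : ι} (h : M i j = 2) : Commute (cs.simple i) (cs.simple j) := by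
  have h2 := cs.simple_mul_simple_pow i j
  rw [h, pow_two] at h2
  have := eq_inv_of_mul_eq_one_left h2
  simpa [Commute, SemiconjBy] using this

theorem braid_simple {i j : ι} (h : M i j = 3) :
    cs.simple i * cs.simple j * cs.simple i = cs.simple j * cs.simple i * cs.simple j := by
  have h3 := cs.simple_mul_simple_pow i j
  have e : (cs.simple i * cs.simple j * cs.simple i) * (cs.simple j * cs.simple i * cs.simple j)
      = 1 := by
    rw [← h3, h]
    simp only [pow_succ, pow_zero, one_mul, mul_assoc]
  simpa [mul_assoc] using eq_inv_of_mul_eq_one_left e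

theorem commute_conj_simple {i j : ι} (h : M i j = 4) :
    Commute (cs.simple i * cs.simple j * cs.simple i) (cs.simple j) := by
  have h4 := cs.simple_mul_simple_pow i j
  have e : (cs.simple i * cs.simple j * cs.simple i * cs.simple j) *
      (cs.simple i * cs.simple j * cs.simple i * cs.simple j) = 1 := by
    rw [← h4, h]
    simp only [pow_succ, pow_zero, one_mul, mul_assoc]
  simpa [mul_assoc, Commute, SemiconjBy] using eq_inv_of_mul_eq_one_left e

theorem finite_of_satisfiesTypeBRelations {G : Type*} [Group G] {s : ℕ → G} {N : ℕ}
    (h : SatisfiesTypeBRelations s N) (f : W →* G) (hf : Function.Injective f)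
    (hmem : ∀ i, f (cs.simple i) ∈ Subgroup.closure (s '' Set.Iio N)) : Finite W := by
  have hW : ∀ w, f w ∈ Subgroup.closure (s '' Set.Iio N) := by
    intro w
    induction w using cs.simple_induction_left with
    | one => simp
    | mul_simple_left w i ih => rw [map_mul]; exact mul_mem (hmem i) ih
  have := (h.finite_closure le_rfl).to_subtype
  exact Finite.of_injective (fun w ↦ (⟨f w, hW w⟩ : Subgroup.closure (s '' Set.Iio N)))
    fun a b hab ↦ hf (congrArg Subtype.val hab)

theorem finite_typeA {n : ℕ} (cs : CoxeterSystem (CoxeterMatrix.A n) W) : Finite W := by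
  let s : ℕ → W := fun k ↦ if h : 0 < k ∧ k - 1 < n then cs.simple ⟨k - 1, h.2⟩ else 1
  have hs0 : s 0 = 1 := by simp [s]
  have hs : ∀ k (hk : k < n), s (k + 1) = cs.simple ⟨k, hk⟩ := fun k hk ↦ by simp [s, hk]
  have hB : SatisfiesTypeBRelations s (n + 1) := by
    constructor
    · rintro (_ | i) hi
      · simp [hs0]
      · simp [hs i (by omega)]
    · intro _
      rw [hs0]
      exact Commute.one_right _
    · rintro (_ | i) h1 hi
      · omega
      · rw [hs i (by omega), hs (i + 1) (by omega)]
        exact cs.braid_simple (by simp [CoxeterMatrix.A])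
    · rintro (_ | i) (_ | j) hij hj
      · omega
      · rw [hs0]
        exact Commute.one_left _
      · omega
      · rw [hs i (by omega), hs j (by omega)]
        refine cs.commute_simple ?_
        have h1 : ¬ i = j := by omega
        have h2 : ¬ (j + 1 = i ∨ i + 1 = j) := by omega
        simp [CoxeterMatrix.A, h1, h2]
  refine cs.finite_of_satisfiesTypeBRelations hB (MonoidHom.id W) Function.injective_id ?_
  intro i
  exact Subgroup.subset_closure ⟨i + 1, by simp, hs i i.2⟩

theorem finite_typeB {n : ℕ} (cs : CoxeterSystem (CoxeterMatrix.B n) W) : Finite W := by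
  -- The numbering is reversed because the edge of weight 4 joins the last two nodes.
  let s : ℕ → W := fun k ↦ if h : k < n then cs.simple ⟨n - 1 - k, by omega⟩ else 1
  have hs : ∀ k (hk : k < n), s k = cs.simple ⟨n - 1 - k, by omega⟩ := fun k hk ↦ by simp [s, hk]
  have hB : SatisfiesTypeBRelations s n := by
    constructor
    · intro i hi
      simp [hs i hi]
    · intro h1
      rw [hs 0 (by omega), hs 1 h1]
      refine cs.commute_conj_simple ?_
      simp only [CoxeterMatrix.B, Matrix.of_apply, Fin.mk.injEq]
      rw [if_neg (by omega), if_pos (by omega)]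
    · intro i h1 hi
      rw [hs i (by omega), hs (i + 1) hi]
      refine cs.braid_simple ?_
      simp only [CoxeterMatrix.B, Matrix.of_apply, Fin.mk.injEq]
      rw [if_neg (by omega), if_neg (by omega), if_pos (by omega)]
    · intro i j hij hj
      rw [hs i (by omega), hs j hj]
      refine cs.commute_simple ?_
      simp only [CoxeterMatrix.B, Matrix.of_apply, Fin.mk.injEq]
      rw [if_neg (by omega), if_neg (by omega), if_neg (by omega)]
  refine cs.finite_of_satisfiesTypeBRelations hB (MonoidHom.id W) Function.injective_id ?_
  intro i
  refine Subgroup.subset_closure ⟨n - 1 - i, ?_, ?_⟩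
  · simp only [Set.mem_Iio]; omega
  · rw [hs _ (by omega)]
    simp only [MonoidHom.id_apply]
    congr 1
    ext
    simp only
    omega

/-- The group automorphism induced by an involutive symmetry of the Coxeter matrix. -/
noncomputable def diagramAut (p : ι → ι) (hp : Function.Involutive p)
    (hM : ∀ i j, M (p i) (p j) = M i j) : MulAut W :=
  have hl : M.IsLiftable (cs.simple ∘ p) := fun i j ↦ by
    rw [← hM]; exact cs.simple_mul_simple_pow _ _
  have hc : (cs.lift ⟨_, hl⟩).comp (cs.lift ⟨_, hl⟩) = MonoidHom.id W :=
    cs.ext_simple fun i ↦ by simp [hp i]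
  MonoidHom.toMulEquiv (cs.lift ⟨_, hl⟩) (cs.lift ⟨_, hl⟩) hc hc

theorem diagramAut_simple (p : ι → ι) (hp : Function.Involutive p)
    (hM : ∀ i j, M (p i) (p j) = M i j) (i : ι) :
    cs.diagramAut p hp hM (cs.simple i) = cs.simple (p i) := by
  exact cs.lift_apply_simple (f := cs.simple ∘ p) _ i

theorem diagramAut_mul_self (p : ι → ι) (hp : Function.Involutive p)
    (hM : ∀ i j, M (p i) (p j) = M i j) :
    cs.diagramAut p hp hM * cs.diagramAut p hp hM = 1 := by
  have : ((cs.diagramAut p hp hM * cs.diagramAut p hp hM : MulAut W) : W →* W) =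
      ((1 : MulAut W) : W →* W) :=
    cs.ext_simple fun i ↦ by simp [diagramAut_simple, hp i]
  ext w
  exact DFunLike.congr_fun this w

/-- As in D_n ⊂ B_n: adjoin the automorphism σ swapping the end nodes u = n - 2 and v = n - 1. In
the semidirect product, σ serves as s_0 and s_u as s_1, and s_v is recovered as s_0 s_1 s_0. -/
theorem finite_typeD {n : ℕ} (hn : 3 ≤ n) (cs : CoxeterSystem (typeDMatrix n) W) :
    Finite W := by
  let u : Fin n := ⟨n - 2, by omega⟩
  let v : Fin n := ⟨n - 1, by omega⟩
  have huv : u ≠ v := by simp only [ne_eq, u, v, Fin.mk.injEq]; omega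
  have hM : ∀ i j, typeDMatrix n (Equiv.swap u v i) (Equiv.swap u v j) = typeDMatrix n i j := by
    intro i j
    simp only [typeDMatrix, Matrix.of_apply, Equiv.apply_eq_iff_eq]
    by_cases hij : i = j
    · simp [hij]
    · simp only [if_neg hij]
      congr 1
      have hi := i.2
      have hj := j.2
      have hu : (u : ℕ) = n - 2 := rfl
      have hv : (v : ℕ) = n - 1 := rfl
      simp only [Equiv.swap_apply_def, Fin.ext_iff] at hij ⊢
      apply propext
      split_ifs <;> omega
  let σ : MulAut W := cs.diagramAut (Equiv.swap u v) (fun i ↦ Equiv.swap_apply_self u v i) hM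
  have hσ : ∀ i, σ (cs.simple i) = cs.simple (Equiv.swap u v i) := cs.diagramAut_simple _ _ hM
  have hσσ : σ * σ = 1 := cs.diagramAut_mul_self _ _ hM
  have hσinv : σ⁻¹ = σ := inv_eq_of_mul_eq_one_right hσσ
  let G := W ⋊[MonoidHom.id (MulAut W)] MulAut W
  have hconj : ∀ w : W, (SemidirectProduct.inr σ * SemidirectProduct.inl w *
      SemidirectProduct.inr σ : G) = SemidirectProduct.inl (σ w) := by
    intro w
    have := SemidirectProduct.inl_aut (φ := MonoidHom.id (MulAut W)) σ w
    rw [hσinv] at this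
    exact this.symm
  have hinr : (SemidirectProduct.inr σ * SemidirectProduct.inr σ : G) = 1 := by
    rw [← map_mul, hσσ, map_one]
  let s : ℕ → G := fun k ↦ if h : 0 < k ∧ k < n then
    SemidirectProduct.inl (cs.simple ⟨n - 1 - k, by omega⟩) else SemidirectProduct.inr σ
  have hs0 : s 0 = SemidirectProduct.inr σ := by simp [s]
  have hs : ∀ k (_ : 0 < k) (hk : k < n), s k =
      SemidirectProduct.inl (cs.simple ⟨n - 1 - k, by omega⟩) := fun k h0 hk ↦ by simp [s, h0, hk]
  have hfix : ∀ k (_ : 1 < k) (hk : k < n),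
      σ (cs.simple ⟨n - 1 - k, by omega⟩) = cs.simple ⟨n - 1 - k, by omega⟩ := by
    intro k h1 hk
    rw [hσ, Equiv.swap_apply_of_ne_of_ne]
    · simp only [ne_eq, u, Fin.mk.injEq]; omega
    · simp only [ne_eq, v, Fin.mk.injEq]; omega
  have hs1 : s 1 = SemidirectProduct.inl (cs.simple u) := hs 1 one_pos (by omega)
  have hconj1 : s 0 * s 1 * s 0 = SemidirectProduct.inl (cs.simple v) := by
    rw [hs0, hs1, hconj, hσ, Equiv.swap_apply_left]
  have h00 : s 0 * s 0 = 1 := by rw [hs0, hinr]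
  have hB : SatisfiesTypeBRelations s n := by
    constructor
    · intro i hi
      rcases Nat.eq_zero_or_pos i with rfl | h0
      · exact h00
      · rw [hs i h0 hi, ← map_mul, simple_mul_simple_self, map_one]
    · intro h1
      have hc : Commute (s 1) (s 0 * s 1 * s 0) := by
        rw [hconj1, hs1]
        refine (cs.commute_simple ?_).map _
        simp only [typeDMatrix, Matrix.of_apply, u, v, Fin.mk.injEq]
        rw [if_neg (by omega), if_neg (by omega)]
      have := hc.eq
      change s 1 * s 0 * s 1 * s 0 = s 0 * (s 1 * s 0 * s 1)
      simpa only [mul_assoc] using this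
    · intro i h1 hi
      rw [hs i (by omega) (by omega), hs (i + 1) (by omega) hi]
      simp only [← map_mul]
      congr 1
      refine cs.braid_simple ?_
      simp only [typeDMatrix, Matrix.of_apply, Fin.mk.injEq]
      rw [if_neg (by omega), if_pos (by omega)]
    · intro i j hij hj
      rcases Nat.eq_zero_or_pos i with rfl | h0
      · have e := hconj (cs.simple ⟨n - 1 - j, by omega⟩)
        rw [hfix j (by omega) hj, ← hs j (by omega) hj, ← hs0] at e
        have := eq_mul_inv_of_mul_eq e
        rwa [inv_eq_of_mul_eq_one_right h00] at this
      · rw [hs i h0 (by omega), hs j (by omega) hj]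
        refine (cs.commute_simple ?_).map _
        simp only [typeDMatrix, Matrix.of_apply, Fin.mk.injEq]
        rw [if_neg (by omega), if_neg (by omega)]
  refine cs.finite_of_satisfiesTypeBRelations hB (SemidirectProduct.inl : W →* G)
    SemidirectProduct.inl_injective ?_
  intro i
  have hmem : ∀ k, k < n → s k ∈ Subgroup.closure (s '' Set.Iio n) := fun k hk ↦
    Subgroup.subset_closure ⟨k, hk, rfl⟩
  by_cases hi : (i : ℕ) = n - 1
  · obtain rfl : i = v := Fin.ext hi
    rw [← hconj1]
    exact mul_mem (mul_mem (hmem 0 (by omega)) (hmem 1 (by omega))) (hmem 0 (by omega))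
  · have e : s (n - 1 - i) = SemidirectProduct.inl (cs.simple i) := by
      rw [hs _ (by omega) (by omega)]
      congr 2
      ext
      simp only
      omega
    rw [← e]
    exact hmem _ (by omega)

end CoxeterSystem

/-! ### Centred descents and moment bounds -/

namespace CoxeterSystem

variable {ι W : Type*} [Group W] {M : CoxeterMatrix ι} (cs : CoxeterSystem M W)

open Classical in
/-- The centred indicator of the right descent `i`. -/
noncomputable def centredDescent (w : W) (i : ι) : ℝ :=
  if cs.IsRightDescent w i then 1 / 2 else -1 / 2

theorem abs_centredDescent (w : W) (i : ι) : |cs.centredDescent w i| = 1 / 2 := by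
  unfold centredDescent
  split_ifs <;> norm_num [abs_of_nonneg, abs_of_neg]

theorem centredDescent_mul_simple_self (w : W) (i : ι) :
    cs.centredDescent (w * cs.simple i) i = -cs.centredDescent w i := by
  classical
  unfold centredDescent
  simp only [isRightDescent_mul_simple_self_iff]
  split_ifs <;> norm_num

/-- The centred number of right descents. -/
noncomputable def centredDes [Fintype ι] (w : W) : ℝ := ∑ i, cs.centredDescent w i

theorem des_eq_centredDes_add [Fintype ι] (w : W) :
    (cs.des w : ℝ) = cs.centredDes w + Fintype.card ι / 2 := by
  classical
  rw [des, Set.ncard_eq_toFinset_card', centredDes]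
  have h : ∀ i, cs.centredDescent w i = (if cs.IsRightDescent w i then 1 else 0) - 1 / 2 := by
    intro i
    unfold centredDescent
    split_ifs <;> norm_num
  simp only [h, Finset.sum_sub_distrib, Finset.sum_boole, Finset.sum_const, Finset.card_univ,
    nsmul_eq_mul, Set.toFinset_ofPred]
  ring

theorem integral_uniformOn_univ {Ω : Type*} [Fintype Ω] [Nonempty Ω] (f : Ω → ℝ) :
    letI : MeasurableSpace Ω := ⊤
    ∫ w, f w ∂(uniformOn (Set.univ : Set Ω)) = (∑ w, f w) / Fintype.card Ω := by
  let : MeasurableSpace Ω := ⊤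
  have : MeasurableSingletonClass Ω := ⟨fun _ ↦ trivial⟩
  rw [uniformOn, ProbabilityTheory.cond, Measure.restrict_univ, integral_smul_measure,
    integral_count, Measure.count_univ]
  simp [ENat.card_eq_coe_fintype_card, div_eq_inv_mul]

section Fintype

variable [Fintype W]

theorem sum_centredDescent_mul_eq_zero (i : ι) (F : W → ℝ)
    (hF : ∀ w, F (w * cs.simple i) = F w) : ∑ w, cs.centredDescent w i * F w = 0 := by
  have h := Equiv.sum_comp (Equiv.mulRight (cs.simple i))
    fun w ↦ cs.centredDescent w i * F w
  simp only [Equiv.coe_mulRight, centredDescent_mul_simple_self, hF, neg_mul,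
    Finset.sum_neg_distrib] at h
  linarith

theorem sum_centredDes_eq_zero [Fintype ι] : ∑ w, cs.centredDes w = 0 := by
  simp only [centredDes]
  rw [Finset.sum_comm]
  refine Finset.sum_eq_zero fun i _ ↦ ?_
  simpa using cs.sum_centredDescent_mul_eq_zero i (fun _ ↦ 1) (fun _ ↦ rfl)

theorem sum_comp_inv (F : W → ℝ) : ∑ w, F w⁻¹ = ∑ w, F w :=
  Equiv.sum_comp (Equiv.inv W) F

theorem fourthCentredMomentT_eq [Fintype ι] : cs.fourthCentredMomentT =
    (∑ w, (cs.centredDes w + cs.centredDes w⁻¹) ^ 4) / Fintype.card W := by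
  have hW : (Fintype.card W : ℝ) ≠ 0 := by
    have := Fintype.card_pos (α := W)
    positivity
  have ht : ∀ w, (cs.tStat w : ℝ) =
      cs.centredDes w + cs.centredDes w⁻¹ + Fintype.card ι := by
    intro w
    rw [tStat, Nat.cast_add, des_eq_centredDes_add, des_eq_centredDes_add]
    ring
  have hmean : (∑ w, (cs.tStat w : ℝ)) / Fintype.card W = Fintype.card ι := by
    simp only [ht, Finset.sum_add_distrib, sum_comp_inv cs.centredDes, sum_centredDes_eq_zero,
      Finset.sum_const, Finset.card_univ, nsmul_eq_mul]
    field_simp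
    ring
  unfold fourthCentredMomentT centralMoment
  rw [integral_uniformOn_univ, integral_uniformOn_univ, hmean]
  congr 1
  refine Finset.sum_congr rfl fun w _ ↦ ?_
  simp [ht]

/-! ### Upper bound -/

variable [Fintype ι]

-- A collects the nodes adjacent to i and i itself: at most four terms of size 1/2. Every other term
-- is unchanged by w ↦ w s_i.
omit [Fintype W] in
theorem exists_local_decomposition (hM : ∀ i j, M i j ∈ ({1, 2, 3, 4} : Set ℕ)) {i : ι}
    (hdeg : {j | M i j ≠ 2}.ncard ≤ 4) : ∃ A : W → ℝ, (∀ w, |A w| ≤ 2) ∧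
      ∀ w, cs.centredDes (w * cs.simple i) - A (w * cs.simple i) = cs.centredDes w - A w := by
  classical
  refine ⟨fun w ↦ ∑ j with M i j ≠ 2, cs.centredDescent w j, fun w ↦ ?_, fun w ↦ ?_⟩
  · refine (Finset.abs_sum_le_sum_abs _ _).trans ?_
    simp only [abs_centredDescent, Finset.sum_const, nsmul_eq_mul]
    rw [Set.ncard_eq_toFinset_card', Set.toFinset_ofPred] at hdeg
    have : ((Finset.univ.filter fun j ↦ M i j ≠ 2).card : ℝ) ≤ 4 := by exact_mod_cast hdeg
    linarith
  · have h : ∀ w, cs.centredDes w - ∑ j with M i j ≠ 2, cs.centredDescent w j =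
        ∑ j with M i j = 2, cs.centredDescent w j := by
      intro w
      rw [centredDes, ← Finset.sum_filter_add_sum_filter_not Finset.univ (fun j ↦ M i j = 2)]
      ring
    rw [h, h]
    refine Finset.sum_congr rfl fun j hj ↦ ?_
    have hj2 : M i j = 2 := by simpa using hj
    have hne : i ≠ j := by
      rintro rfl
      simp at hj2
    unfold centredDescent
    simp only [cs.isRightDescent_mul_simple_iff_of_commute ((cs.simple_injective hM).ne hne)
      (cs.commute_simple hj2) w]

theorem sum_centredDes_mul (F : W → ℝ) :
    ∑ w, cs.centredDes w * F w = ∑ i, ∑ w, cs.centredDescent w i * F w := by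
  rw [Finset.sum_comm]
  simp only [centredDes, Finset.sum_mul]

theorem sum_centredDes_sq_le (hM : ∀ i j, M i j ∈ ({1, 2, 3, 4} : Set ℕ))
    (hdeg : ∀ i, {j | M i j ≠ 2}.ncard ≤ 4) :
    ∑ w, cs.centredDes w ^ 2 ≤ Fintype.card ι * Fintype.card W := by
  have hi : ∀ i, ∑ w, cs.centredDescent w i * cs.centredDes w ≤ Fintype.card W := by
    intro i
    obtain ⟨A, hA, hinv⟩ := cs.exists_local_decomposition hM (hdeg i)
    have h0 := cs.sum_centredDescent_mul_eq_zero i (fun w ↦ cs.centredDes w - A w) hinv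
    calc ∑ w, cs.centredDescent w i * cs.centredDes w
        = ∑ w, cs.centredDescent w i * A w := by
          rw [← sub_eq_zero, ← Finset.sum_sub_distrib, ← h0]
          exact Finset.sum_congr rfl fun w _ ↦ by ring
      _ ≤ ∑ w : W, (1 : ℝ) := by
          refine Finset.sum_le_sum fun w _ ↦ (le_abs_self _).trans ?_
          rw [abs_mul, abs_centredDescent]
          linarith [hA w]
      _ = _ := by simp
  simp only [pow_two]
  rw [sum_centredDes_mul]
  refine (Finset.sum_le_sum fun i _ ↦ hi i).trans_eq ?_
  simp

theorem sum_centredDes_pow_four_le (hM : ∀ i j, M i j ∈ ({1, 2, 3, 4} : Set ℕ))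
    (hdeg : ∀ i, {j | M i j ≠ 2}.ncard ≤ 4) :
    ∑ w, cs.centredDes w ^ 4 ≤
      (9 / 2 * Fintype.card ι ^ 2 + 10 * Fintype.card ι) * Fintype.card W := by
  have hi : ∀ i, ∑ w, cs.centredDescent w i * cs.centredDes w ^ 3 ≤
      9 / 2 * ∑ w, cs.centredDes w ^ 2 + 10 * Fintype.card W := by
    intro i
    obtain ⟨A, hA, hinv⟩ := cs.exists_local_decomposition hM (hdeg i)
    have h0 := cs.sum_centredDescent_mul_eq_zero i
      (fun w ↦ (cs.centredDes w - A w) ^ 3) fun w ↦ by simp only [hinv w]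
    calc ∑ w, cs.centredDescent w i * cs.centredDes w ^ 3
        = ∑ w, cs.centredDescent w i * A w *
            (3 * cs.centredDes w ^ 2 - 3 * cs.centredDes w * A w + A w ^ 2) := by
          rw [← sub_eq_zero, ← Finset.sum_sub_distrib, ← h0]
          exact Finset.sum_congr rfl fun w _ ↦ by ring
      -- Here X_i A ≤ 1, the quadratic form is non-negative, and -3XA ≤ (3/2)(X² + A²) with A² ≤ 4
      -- gives 10 = (5/2)·4.
      _ ≤ ∑ w, (9 / 2 * cs.centredDes w ^ 2 + 10) := by
          refine Finset.sum_le_sum fun w _ ↦ ?_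
          have h1 : cs.centredDescent w i * A w ≤ 1 := by
            refine (le_abs_self _).trans ?_
            rw [abs_mul, abs_centredDescent]
            linarith [hA w]
          have h2 : A w ^ 2 ≤ 4 := by
            have := sq_le_sq' (abs_le.mp (hA w)).1 (abs_le.mp (hA w)).2
            linarith
          have h3 : 0 ≤ 3 * cs.centredDes w ^ 2 - 3 * cs.centredDes w * A w + A w ^ 2 := by
            nlinarith [sq_nonneg (cs.centredDes w), sq_nonneg (3 * cs.centredDes w - 2 * A w)]
          have h4 := mul_le_mul_of_nonneg_right h1 h3
          nlinarith [sq_nonneg (cs.centredDes w + A w)]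
      _ = _ := by
          rw [Finset.sum_add_distrib, ← Finset.mul_sum]
          simp [mul_comm]
  have e : ∀ w, cs.centredDes w ^ 4 = cs.centredDes w * cs.centredDes w ^ 3 := fun w ↦ by ring
  simp only [e]
  rw [sum_centredDes_mul]
  refine (Finset.sum_le_sum fun i _ ↦ hi i).trans ?_
  rw [Finset.sum_const, Finset.card_univ, nsmul_eq_mul]
  have h2 := mul_le_mul_of_nonneg_left (cs.sum_centredDes_sq_le hM hdeg)
    (Nat.cast_nonneg (α := ℝ) (Fintype.card ι))
  nlinarith

theorem fourthCentredMomentT_le (hM : ∀ i j, M i j ∈ ({1, 2, 3, 4} : Set ℕ))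
    (hdeg : ∀ i, {j | M i j ≠ 2}.ncard ≤ 4) :
    cs.fourthCentredMomentT ≤ 232 * (Fintype.card ι : ℝ) ^ 2 := by
  have hW : (0 : ℝ) < Fintype.card W := by exact_mod_cast Fintype.card_pos (α := W)
  rw [fourthCentredMomentT_eq, div_le_iff₀ hW]
  have hpt : ∀ a b : ℝ, (a + b) ^ 4 ≤ 8 * (a ^ 4 + b ^ 4) := by
    intro a b
    nlinarith [sq_nonneg (a - b), sq_nonneg (a ^ 2 - b ^ 2), sq_nonneg (a + b),
      mul_nonneg (sq_nonneg (a - b)) (sq_nonneg (a + b)), sq_nonneg ((a - b) ^ 2)]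
  have h1 : ∑ w, (cs.centredDes w + cs.centredDes w⁻¹) ^ 4 ≤
      16 * ∑ w, cs.centredDes w ^ 4 := by
    refine (Finset.sum_le_sum fun w _ ↦ hpt _ _).trans_eq ?_
    rw [← Finset.mul_sum, Finset.sum_add_distrib, sum_comp_inv fun w ↦ cs.centredDes w ^ 4]
    ring
  have h2 := cs.sum_centredDes_pow_four_le hM hdeg
  have h3 : (Fintype.card ι : ℝ) ≤ (Fintype.card ι : ℝ) ^ 2 := by
    exact_mod_cast Nat.le_self_pow two_ne_zero _
  -- 232 = 16 · (9/2 + 10).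
  nlinarith

/-! ### Lower bound -/

-- Pair w with s_j w. The factor at w⁻¹ changes sign and the factor at w does not, so the pair
-- cancels, unless s_j w = w s_i; then the two factors agree and both products are positive.
omit [Fintype ι] in
theorem sum_centredDescent_mul_centredDescent_inv_nonneg (i j : ι) :
    0 ≤ ∑ w, cs.centredDescent w i * cs.centredDescent w⁻¹ j := by
  classical
  have h := Equiv.sum_comp (Equiv.mulLeft (cs.simple j))
    fun w ↦ cs.centredDescent w i * cs.centredDescent w⁻¹ j
  simp only [Equiv.coe_mulLeft, mul_inv_rev, inv_simple, centredDescent_mul_simple_self] at h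
  have h2 : 0 ≤ ∑ w, (cs.centredDescent w i * cs.centredDescent w⁻¹ j +
      cs.centredDescent (cs.simple j * w) i * -cs.centredDescent w⁻¹ j) := by
    refine Finset.sum_nonneg fun w _ ↦ ?_
    by_cases hw : cs.simple j * w = w * cs.simple i
    · have e : cs.centredDescent w⁻¹ j = cs.centredDescent w i := by
        have hiff : cs.IsRightDescent w⁻¹ j ↔ cs.IsRightDescent w i := by
          rw [isRightDescent_inv_iff, IsLeftDescent, IsRightDescent, hw]
        simp only [centredDescent, hiff]
      rw [hw, centredDescent_mul_simple_self, e]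
      nlinarith [mul_self_nonneg (cs.centredDescent w i)]
    · have e : cs.centredDescent (cs.simple j * w) i = cs.centredDescent w i := by
        unfold centredDescent
        simp only [cs.isRightDescent_simple_mul_iff hw]
      rw [e]
      simp
  rw [Finset.sum_add_distrib, h] at h2
  linarith

theorem sum_centredDes_mul_centredDes_inv_nonneg :
    0 ≤ ∑ w, cs.centredDes w * cs.centredDes w⁻¹ := by
  rw [sum_centredDes_mul]
  refine Finset.sum_nonneg fun i _ ↦ ?_
  simp only [centredDes, Finset.mul_sum]
  rw [Finset.sum_comm]
  exact Finset.sum_nonneg fun j _ ↦ cs.sum_centredDescent_mul_centredDescent_inv_nonneg i j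

-- H is the dihedral subgroup of s_i and s_j. An upper bound on its size suffices, so the exact
-- order of s_i s_j is not needed.
omit [Fintype ι] [Fintype W] in
theorem exists_finset_mul_simple_mem {i j : ι} (hm : M i j ≠ 0) :
    ∃ H : Finset W, H.Nonempty ∧ H.card ≤ 2 * M i j ∧
      ∀ h ∈ H, h * cs.simple i ∈ H ∧ h * cs.simple j ∈ H := by
  classical
  have hc := cs.simple_mul_simple_pow i j
  set c := cs.simple i * cs.simple j with hcdef
  set m := M i j
  have hmod : ∀ k, c ^ k = c ^ (k % m) := fun k ↦ pow_eq_pow_mod k hc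
  let H : Finset W := (Finset.range m).image (fun k ↦ c ^ k) ∪
    (Finset.range m).image (fun k ↦ c ^ k * cs.simple i)
  have h1 : ∀ k, c ^ k ∈ H := fun k ↦ Finset.mem_union_left _ <| by
    rw [hmod]
    exact Finset.mem_image_of_mem _ (Finset.mem_range.mpr (Nat.mod_lt _ (by omega)))
  have h2 : ∀ k, c ^ k * cs.simple i ∈ H := fun k ↦ Finset.mem_union_right _ <| by
    rw [hmod]
    exact Finset.mem_image_of_mem (fun k ↦ c ^ k * cs.simple i)
      (Finset.mem_range.mpr (Nat.mod_lt _ (by omega)))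
  refine ⟨H, ⟨_, h1 0⟩, ?_, ?_⟩
  · refine (Finset.card_union_le _ _).trans ?_
    rw [two_mul]
    exact add_le_add (Finset.card_image_le.trans_eq (Finset.card_range m))
      (Finset.card_image_le.trans_eq (Finset.card_range m))
  · intro h hh
    rcases Finset.mem_union.mp hh with hh | hh
    · obtain ⟨k, -, rfl⟩ := Finset.mem_image.mp hh
      refine ⟨h2 k, ?_⟩
      have e : c ^ k * cs.simple j = c ^ (k + (m - 1)) * cs.simple i := by
        have hi : cs.simple i = c * cs.simple j := by simp [hcdef]
        rw [hi, ← mul_assoc, ← pow_succ, show k + (m - 1) + 1 = k + m by omega, pow_add, hc,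
          mul_one]
      rw [e]
      exact h2 _
    · obtain ⟨k, -, rfl⟩ := Finset.mem_image.mp hh
      refine ⟨by simpa using h1 k, ?_⟩
      rw [mul_assoc, ← hcdef, ← pow_succ]
      exact h1 _

omit [Fintype ι] in
theorem card_le_card_mul_card {G : Type*} [Group G] [Fintype G] (P H : Finset G)
    (h : ∀ w, ∃ x ∈ H, w * x ∈ P) : Fintype.card G ≤ P.card * H.card := by
  classical
  rw [← Finset.card_univ, ← Finset.card_product]
  refine Finset.card_le_card_of_surjOn (fun p : G × G ↦ p.1 * p.2⁻¹) ?_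
  intro w _
  obtain ⟨x, hx, hw⟩ := h w
  exact ⟨(w * x, x), by simp [hx, hw], by simp⟩

-- Every translate wH contains an element of minimal length, with neither descent, and one of
-- maximal length, with both. So P and Q each have density at least 1/(2m), and X_i X_j is 1/4 on P
-- ∪ Q and -1/4 elsewhere.
omit [Fintype ι] in
theorem le_sum_centredDescent_mul (i j : ι) (hm : M i j ≠ 0) :
    (1 / (2 * (M i j : ℝ)) - 1 / 4) * Fintype.card W ≤
      ∑ w, cs.centredDescent w i * cs.centredDescent w j := by
  classical
  obtain ⟨H, hH, hcard, hmem⟩ := cs.exists_finset_mul_simple_mem hm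
  let P : Finset W := {w | ¬ cs.IsRightDescent w i ∧ ¬ cs.IsRightDescent w j}
  let Q : Finset W := {w | cs.IsRightDescent w i ∧ cs.IsRightDescent w j}
  have hP : Fintype.card W ≤ P.card * H.card := by
    refine card_le_card_mul_card P H fun w ↦ ?_
    obtain ⟨x, hx, hmin⟩ := H.exists_min_image (fun x ↦ cs.length (w * x)) hH
    refine ⟨x, hx, ?_⟩
    have h1 := hmin _ (hmem x hx).1
    have h2 := hmin _ (hmem x hx).2
    refine Finset.mem_filter.mpr ⟨Finset.mem_univ _, ?_⟩
    simp only [IsRightDescent, mul_assoc]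
    omega
  have hQ : Fintype.card W ≤ Q.card * H.card := by
    refine card_le_card_mul_card Q H fun w ↦ ?_
    obtain ⟨x, hx, hmax⟩ := H.exists_max_image (fun x ↦ cs.length (w * x)) hH
    refine ⟨x, hx, ?_⟩
    have h1 := hmax _ (hmem x hx).1
    have h2 := hmax _ (hmem x hx).2
    have h3 := cs.length_mul_simple_ne (w * x) i
    have h4 := cs.length_mul_simple_ne (w * x) j
    simp only [mul_assoc] at h3 h4
    refine Finset.mem_filter.mpr ⟨Finset.mem_univ _, ?_⟩
    simp only [IsRightDescent, mul_assoc]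
    omega
  have hpt : ∀ w, cs.centredDescent w i * cs.centredDescent w j =
      1 / 2 * (if ¬ cs.IsRightDescent w i ∧ ¬ cs.IsRightDescent w j then 1 else 0) +
      1 / 2 * (if cs.IsRightDescent w i ∧ cs.IsRightDescent w j then 1 else 0) - 1 / 4 := by
    intro w
    unfold centredDescent
    by_cases h1 : cs.IsRightDescent w i <;> by_cases h2 : cs.IsRightDescent w j <;>
      simp [h1, h2] <;> norm_num
  simp only [hpt, Finset.sum_sub_distrib, Finset.sum_add_distrib, ← Finset.mul_sum,
    Finset.sum_boole, Finset.sum_const, Finset.card_univ, nsmul_eq_mul]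
  change _ ≤ 1 / 2 * (P.card : ℝ) + 1 / 2 * (Q.card : ℝ) - _
  have hm' : (0 : ℝ) < 2 * (M i j : ℝ) := by
    have := Nat.pos_of_ne_zero hm
    positivity
  have key : ∀ R : Finset W, Fintype.card W ≤ R.card * H.card →
      1 / (2 * (M i j : ℝ)) * Fintype.card W ≤ R.card := by
    intro R hR
    rw [one_div_mul_eq_div, div_le_iff₀ hm']
    exact_mod_cast hR.trans (Nat.mul_le_mul_left _ hcard)
  have := key P hP
  have := key Q hQ
  linarith

theorem le_fourthCentredMomentT (hM : ∀ i j, M i j ≠ 0) {κ : ℝ} (hκ : 0 ≤ κ)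
    (hsum : κ ≤ ∑ i, ∑ j, (1 / (2 * (M i j : ℝ)) - 1 / 4)) :
    4 * κ ^ 2 ≤ cs.fourthCentredMomentT := by
  have hW : (0 : ℝ) < Fintype.card W := by exact_mod_cast Fintype.card_pos (α := W)
  have hvar : κ * Fintype.card W ≤ ∑ w, cs.centredDes w ^ 2 := by
    refine (mul_le_mul_of_nonneg_right hsum hW.le).trans ?_
    simp only [pow_two]
    rw [sum_centredDes_mul, Finset.sum_mul]
    refine Finset.sum_le_sum fun i _ ↦ ?_
    simp only [centredDes, Finset.mul_sum]
    rw [Finset.sum_comm, Finset.sum_mul]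
    exact Finset.sum_le_sum fun j _ ↦ cs.le_sum_centredDescent_mul i j (hM i j)
  have h2 : 2 * (κ * Fintype.card W) ≤ ∑ w, (cs.centredDes w + cs.centredDes w⁻¹) ^ 2 := by
    have e : ∑ w, (cs.centredDes w + cs.centredDes w⁻¹) ^ 2 =
        2 * ∑ w, cs.centredDes w ^ 2 + 2 * ∑ w, cs.centredDes w * cs.centredDes w⁻¹ := by
      rw [two_mul, ← sum_comp_inv fun w ↦ cs.centredDes w ^ 2]
      nth_rewrite 1 [sum_comp_inv fun w ↦ cs.centredDes w ^ 2]
      rw [Finset.mul_sum, ← Finset.sum_add_distrib, ← Finset.sum_add_distrib]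
      exact Finset.sum_congr rfl fun w _ ↦ by ring
    have := cs.sum_centredDes_mul_centredDes_inv_nonneg
    linarith
  have hcs := sq_sum_le_card_mul_sum_sq (s := Finset.univ)
    (f := fun w ↦ (cs.centredDes w + cs.centredDes w⁻¹) ^ 2)
  simp only [← pow_mul, Finset.card_univ] at hcs
  have h3 : (2 * (κ * Fintype.card W)) ^ 2 ≤
      (∑ w, (cs.centredDes w + cs.centredDes w⁻¹) ^ 2) ^ 2 :=
    pow_le_pow_left₀ (by positivity) h2 2
  rw [fourthCentredMomentT_eq, le_div_iff₀ hW]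
  refine le_of_mul_le_mul_left (le_trans (le_of_eq ?_) (h3.trans hcs)) hW
  ring

end Fintype

end CoxeterSystem

/-! ### Numerical conditions on the diagrams -/

namespace CoxeterMatrix

theorem ncard_le_four {n : ℕ} {S : Set (Fin n)} (a b c d : ℕ)
    (h : ∀ j ∈ S, (j : ℕ) = a ∨ (j : ℕ) = b ∨ (j : ℕ) = c ∨ (j : ℕ) = d) : S.ncard ≤ 4 := by
  rw [← Set.ncard_image_of_injective S Fin.val_injective]
  refine (Set.ncard_le_ncard (t := (({a, b, c, d} : Finset ℕ) : Set ℕ)) ?_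
    (Finset.finite_toSet _)).trans ?_
  · rintro _ ⟨j, hj, rfl⟩
    simpa using h j hj
  · rw [Set.ncard_coe_finset]
    exact Finset.card_le_four

/-- A lower bound for a forest diagram in which `p i` is the parent of the node `i` and the edge
joining them contributes at least `-α i`. -/
theorem le_sum_sum_of_parent {n : ℕ} (M : CoxeterMatrix (Fin n)) (p : Fin n → ℕ)
    (α : Fin n → ℝ) (hα : ∀ i, 0 ≤ α i)
    (h : ∀ i j : Fin n, (if i = j then (1 / 4 : ℝ) else 0) - (if (j : ℕ) = p i then α i else 0) -
      (if (i : ℕ) = p j then α j else 0) ≤ 1 / (2 * (M i j : ℝ)) - 1 / 4) :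
    (n : ℝ) / 4 - 2 * ∑ i, α i ≤ ∑ i, ∑ j, (1 / (2 * (M i j : ℝ)) - 1 / 4) := by
  have hrow : ∀ i, ∑ j : Fin n, (if (j : ℕ) = p i then α i else 0) ≤ α i := by
    intro i
    by_cases hp : p i < n
    · have : ∀ j : Fin n, (j : ℕ) = p i ↔ j = ⟨p i, hp⟩ := fun j ↦ by simp [Fin.ext_iff]
      simp [this]
    · rw [Finset.sum_eq_zero]
      · exact hα i
      · intro j _
        rw [if_neg]
        omega
  have hsum := Finset.sum_le_sum fun i (_ : i ∈ Finset.univ) ↦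
    Finset.sum_le_sum fun j (_ : j ∈ Finset.univ) ↦ h i j
  refine le_trans ?_ hsum
  simp only [Finset.sum_sub_distrib]
  rw [Finset.sum_comm (f := fun i j : Fin n ↦ if (i : ℕ) = p j then α j else 0)]
  have h1 := Finset.sum_le_sum fun i (_ : i ∈ Finset.univ) ↦ hrow i
  have h2 : ∑ i : Fin n, ∑ j : Fin n, (if i = j then (1 / 4 : ℝ) else 0) = n / 4 := by
    simp [div_eq_mul_inv]
  linarith

/-- The properties of a Coxeter matrix of rank `n` on which the moment bounds depend. -/
structure HasMomentBounds {ι : Type*} [Fintype ι] (M : CoxeterMatrix ι) (n : ℕ) : Prop where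
  card_eq : Fintype.card ι = n
  mem : ∀ i j, M i j ∈ ({1, 2, 3, 4} : Set ℕ)
  degree_le : ∀ i, {j | M i j ≠ 2}.ncard ≤ 4
  le_sum : (n : ℝ) / 24 ≤ ∑ i, ∑ j, (1 / (2 * (M i j : ℝ)) - 1 / 4)

theorem HasMomentBounds.of_reindex {ι κ : Type*} [Fintype ι] [Fintype κ] {M : CoxeterMatrix ι}
    {e : ι ≃ κ} {n : ℕ} (h : (M.reindex e).HasMomentBounds n) : M.HasMomentBounds n := by
  have hM : ∀ i j, M i j = M.reindex e (e i) (e j) := fun i j ↦ by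
    simp [CoxeterMatrix.reindex_apply]
  refine ⟨(Fintype.card_congr e).trans h.card_eq, fun i j ↦ hM i j ▸ h.mem _ _, fun i ↦ ?_, ?_⟩
  · refine le_trans (le_of_eq ?_) (h.degree_le (e i))
    rw [← Set.ncard_image_of_injective _ e.injective]
    congr 1
    ext k
    obtain ⟨j, rfl⟩ := e.surjective k
    simp [hM]
  · refine h.le_sum.trans (le_of_eq ?_)
    rw [← Equiv.sum_comp e]
    refine Finset.sum_congr rfl fun i _ ↦ ?_
    rw [← Equiv.sum_comp e]
    simp only [hM]

theorem hasMomentBounds_A (n : ℕ) : (CoxeterMatrix.A n).HasMomentBounds n := by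
  refine ⟨Fintype.card_fin n, fun i j ↦ ?_, fun i ↦ ?_, ?_⟩
  · simp only [CoxeterMatrix.A, Matrix.of_apply]
    split_ifs <;> simp
  · refine ncard_le_four i (i - 1) (i + 1) i fun j hj ↦ ?_
    simp only [CoxeterMatrix.A, Matrix.of_apply, Set.mem_ofPred_eq, Fin.ext_iff] at hj
    split_ifs at hj <;> omega
  -- An edge of weight 3 contributes 1/6 - 1/4 = -1/12. Truncated subtraction makes node 0 its own
  -- parent, which only weakens the bound.
  · refine le_trans ?_ (le_sum_sum_of_parent _ (fun i ↦ i - 1) (fun _ ↦ 1 / 12)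
      (fun _ ↦ by norm_num) fun i j ↦ ?_)
    · simp only [Finset.sum_const, Finset.card_univ, Fintype.card_fin, nsmul_eq_mul]
      have : (0 : ℝ) ≤ n := Nat.cast_nonneg n
      linarith
    · simp only [CoxeterMatrix.A, Matrix.of_apply, Fin.ext_iff]
      split_ifs <;> first | (exfalso; omega) | norm_num

theorem hasMomentBounds_B (n : ℕ) : (CoxeterMatrix.B n).HasMomentBounds n := by
  refine ⟨Fintype.card_fin n, fun i j ↦ ?_, fun i ↦ ?_, ?_⟩
  · simp only [CoxeterMatrix.B, Matrix.of_apply]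
    split_ifs <;> simp
  · refine ncard_le_four i (i - 1) (i + 1) i fun j hj ↦ ?_
    simp only [CoxeterMatrix.B, Matrix.of_apply, Set.mem_ofPred_eq, Fin.ext_iff] at hj
    split_ifs at hj <;> omega
  · refine le_trans ?_ (le_sum_sum_of_parent _ (fun i ↦ i - 1)
      -- The edge of weight 4 contributes -1/8 = -(1/12 + 1/24). The extra 1/24 is at most n/48, and
      -- n/4 - 2(n/12 + n/48) = n/24 is the worst of the three types.
      (fun i ↦ 1 / 12 + if (i : ℕ) + 1 = n ∧ 2 ≤ n then 1 / 24 else 0)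
      (fun _ ↦ by positivity) fun i j ↦ ?_)
    · have hn : ∑ i : Fin n, (if (i : ℕ) + 1 = n ∧ 2 ≤ n then (1 / 24 : ℝ) else 0) ≤ n / 48 := by
        by_cases h2 : 2 ≤ n
        · have : ∀ i : Fin n, ((i : ℕ) + 1 = n ∧ 2 ≤ n) ↔ i = ⟨n - 1, by omega⟩ := fun i ↦ by
            simp only [Fin.ext_iff]
            omega
          have hn2 : (2 : ℝ) ≤ n := by exact_mod_cast h2
          simp only [this, Finset.sum_ite_eq', Finset.mem_univ, if_true]
          linarith
        · simp only [h2, and_false, if_false, Finset.sum_const_zero]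
          positivity
      rw [Finset.sum_add_distrib]
      simp only [Finset.sum_const, Finset.card_univ, Fintype.card_fin, nsmul_eq_mul]
      linarith
    · have hi := i.2
      have hj := j.2
      simp only [CoxeterMatrix.B, Matrix.of_apply, Fin.ext_iff]
      split_ifs <;> first | (exfalso; omega) | norm_num

theorem hasMomentBounds_typeDMatrix (n : ℕ) : (typeDMatrix n).HasMomentBounds n := by
  refine ⟨Fintype.card_fin n, fun i j ↦ ?_, fun i ↦ ?_, ?_⟩
  · simp only [typeDMatrix, Matrix.of_apply]
    split_ifs <;> simp
  · refine ncard_le_four i (i + 1) (if (i : ℕ) + 1 = n then i - 2 else i - 1) (i + 2)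
      fun j hj ↦ ?_
    simp only [typeDMatrix, Matrix.of_apply, Set.mem_ofPred_eq, Fin.ext_iff] at hj
    have hi := i.2
    split_ifs at hj ⊢ <;> omega
  · refine le_trans ?_ (le_sum_sum_of_parent _
      (fun i ↦ if (i : ℕ) + 1 = n then i - 2 else i - 1) (fun _ ↦ 1 / 12)
      (fun _ ↦ by norm_num) fun i j ↦ ?_)
    · simp only [Finset.sum_const, Finset.card_univ, Fintype.card_fin, nsmul_eq_mul]
      have : (0 : ℝ) ≤ n := Nat.cast_nonneg n
      linarith
    · have hi := i.2
      have hj := j.2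
      simp only [typeDMatrix, Matrix.of_apply, Fin.ext_iff]
      split_ifs <;> first | (exfalso; omega) | norm_num

end CoxeterMatrix

theorem CoxeterSystem.fourthCentredMomentT_bounds {ι W : Type*} [Group W] [Finite W] [Fintype ι]
    {M : CoxeterMatrix ι} (cs : CoxeterSystem M W) {n : ℕ} (h : M.HasMomentBounds n) :
    1 / 144 * (n : ℝ) ^ 2 ≤ cs.fourthCentredMomentT ∧
      cs.fourthCentredMomentT ≤ 232 * (n : ℝ) ^ 2 := by
  have := Fintype.ofFinite W
  have hne : ∀ i j, M i j ≠ 0 := fun i j h0 ↦ by simpa [h0] using h.mem i j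
  constructor
  -- With κ = n/24, 4κ² = n²/144.
  · refine le_trans (le_of_eq ?_) (cs.le_fourthCentredMomentT hne (by positivity) h.le_sum)
    ring
  · rw [← h.card_eq]
    exact cs.fourthCentredMomentT_le h.mem h.degree_le

theorem theorem3p1 :
    ∃ c C : ℝ, 0 < c ∧ 0 < C ∧
      ∀ (n : ℕ) (ι : Type*) (W : Type*) [Group W] (M : CoxeterMatrix ι) (cs : CoxeterSystem M W),
        M.IsIrreducibleABD n →
          Finite W ∧
          c * (n : ℝ) ^ 2 ≤ cs.fourthCentredMomentT ∧
          cs.fourthCentredMomentT ≤ C * (n : ℝ) ^ 2 := by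
  refine ⟨1 / 144, 232, by norm_num, by norm_num, ?_⟩
  intro n ι W _ M cs hM
  rcases hM with ⟨-, e, he⟩ | ⟨-, e, he⟩ | ⟨hn, e, he⟩
  all_goals
    have := Fintype.ofEquiv _ e.symm
    have cs' := cs.reindex e
    rw [he] at cs'
  · have hW := cs'.finite_typeA
    have hB : (M.reindex e).HasMomentBounds n := he ▸ CoxeterMatrix.hasMomentBounds_A n
    exact ⟨hW, cs.fourthCentredMomentT_bounds hB.of_reindex⟩
  · have hW := cs'.finite_typeB
    have hB : (M.reindex e).HasMomentBounds n := he ▸ CoxeterMatrix.hasMomentBounds_B n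
    exact ⟨hW, cs.fourthCentredMomentT_bounds hB.of_reindex⟩
  · have hW := cs'.finite_typeD hn
    have hB : (M.reindex e).HasMomentBounds n := he ▸ CoxeterMatrix.hasMomentBounds_typeDMatrix n
    exact ⟨hW, cs.fourthCentredMomentT_bounds hB.of_reindex⟩
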